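/- Let $D,E$ be finite sets, $n\ge 0$ an integer, $\mathcal D\subseteq D^n$ and $f:\mathcal D\to E$. For an integer $k>0$ let $f^{(k)}:\mathcal D^k\to E^k$, $f^{(k)}(x^1,\dots,x^k)=(f(x^1),\dots,f(x^k))$, be the function computing $k$ independent copies of $f$; its input is regarded as a string of length $kn$ over $D$. *Query complexity.* For $g:\mathcal C\to E'$ with $\mathcal C\subseteq D^N$, $Q_\epsilon(g)$ is the minimum number $T$ of queries of a quantum algorithm that on every input $x\in\mathcal C$ outputs $g(x)$ with probability at least $1-\epsilon$. Here an algorithm alternates arbitrary unitaries $U_0,\dots,U_T$ that do not depend on the input with $T$ applications of the query operator $O_x$ and ends with a measurement; the query operator acts on an index register, an answer register and a finite-dimensional workspace by $O_x|i,b,w\rangle=|i,b+x_i,w\rangle$ for $1\le i\le N$ and $O_x|{\rm none},b,w\rangle=|{\rm none},b,w\rangle$, where the answer register is indexed by an arbitrary finite abelian group $G$ into which $D$ is injected (for example $G=\mathbb Z/|D|\mathbb Z$). The result holds for every choice of $G$ and of the injection $D\hookrightarrow G$. *Additive adversary bound.* Let $J$ be the all-ones $\mathcal D\times\mathcal D$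 matrix, $F(x,y)=\delta_{f(x),f(y)}$ and $\Delta_i(x,y)=\delta_{x_i,y_i}$ for $x,y\in\mathcal D$, $1\le i\le n$, and let $\circ$ denote the entrywise product. Then $$\mathrm{ADV}(F)=\max\bigl\{\|\Gamma\circ(J-F)\| \;:\; \Gamma \text{ Hermitian},\ I\pm\Gamma\circ(J-\Delta_i)\succeq 0\text{ for all } 1\le i\le n\bigr\},$$ where $\Gamma$ ranges over complex $\mathcal D\times\mathcal D$ matrices and $\|\cdot\|$ is the spectral norm. **Theorem (strong direct product theorem).** For every such $f$, every real $\delta$ with $2/3\le\delta\le 1$ and every integer $k>0$, $$Q_{1-\delta^{k/2}}\bigl(f^{(k)}\bigr)\;\ge\;\frac{k\ln(3\delta/2)}{8}\,\mathrm{ADV}(F).$$ -/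

import Mathlib

open scoped Matrix ENNReal ComplexOrder

noncomputable section

namespace QuantumQuery

/-! ### Functions and independent copies -/

/-- The domain `𝒟 ^ k`, for `𝒟 ⊆ D ^ ι`, as a subset of `D ^ (k × ι)`: the string `x` consists of
the `k` blocks `x (p, ·)`, each of which has to lie in `𝒟`. -/
def powDomain {ι D : Type*} [Fintype ι] [DecidableEq ι] [Fintype D] [DecidableEq D]
    (k : ℕ) (𝒟 : Finset (ι → D)) : Finset (Fin k × ι → D) :=
  Finset.univ.filter fun x => ∀ p : Fin k, (fun i => x (p, i)) ∈ 𝒟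

/-- The function `f^(k) (x¹, …, xᵏ) = (f x¹, …, f xᵏ)`. -/
def funPow {ι D E : Type*} [Fintype ι] [DecidableEq ι] [Fintype D] [DecidableEq D]
    (k : ℕ) {𝒟 : Finset (ι → D)} (f : 𝒟 → E) : powDomain k 𝒟 → (Fin k → E) :=
  fun x p => f ⟨fun i => x.1 (p, i), (Finset.mem_filter.mp x.2).2 p⟩

/-! ### Quantum query algorithms -/

/-- The computational basis of the registers of an algorithm: an index register (where `none` means
that no position is queried), an answer register indexed by the group `G`, and an `m`-dimensional
workspace. -/
abbrev Basis (ι G : Type*) (m : ℕ) : Type _ := Option ι × G × Fin m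

/-- The query operator for the input `x`: it is the linear map with
`|i, b, w⟩ ↦ |i, b + enc (x i), w⟩` and `|none, b, w⟩ ↦ |none, b, w⟩`, written on amplitudes. -/
def query {ι D G : Type*} [AddCommGroup G] (enc : D ↪ G) (x : ι → D) {m : ℕ}
    (ψ : Basis ι G m → ℂ) : Basis ι G m → ℂ
  | (none, b, w) => ψ (none, b, w)
  | (some i, b, w) => ψ (some i, b - enc (x i), w)

/-- A quantum query algorithm with outputs in `E`: its number `T` of queries, the dimension of its
workspace, the input-independent unitaries `U 0, …, U T` (the other values of `U` are not used),
the basis state it starts in, and the output attached to each outcome of the final measurement in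
the computational basis. -/
structure Algorithm (ι G E : Type*) [Fintype ι] [DecidableEq ι] [Fintype G] [DecidableEq G] where
  numQueries : ℕ
  workDim : ℕ
  U : ℕ → Matrix.unitaryGroup (Basis ι G workDim) ℂ
  start : Basis ι G workDim
  out : Basis ι G workDim → E

namespace Algorithm

variable {ι D G E : Type*} [Fintype ι] [DecidableEq ι] [Fintype G] [DecidableEq G]
  [AddCommGroup G]

/-- The state `U t · O_x · U (t - 1) ⋯ O_x · U 0 |start⟩` after `t` queries on the input `x`. -/
def state (A : Algorithm ι G E) (enc : D ↪ G) (x : ι → D) : ℕ → (Basis ι G A.workDim → ℂ)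
  | 0 => (A.U 0 : Matrix _ _ ℂ) *ᵥ Pi.single A.start 1
  | t + 1 => (A.U (t + 1) : Matrix _ _ ℂ) *ᵥ query enc x (A.state enc x t)

/-- The probability that the algorithm outputs `e` on the input `x`. -/
def outputProb [DecidableEq E] (A : Algorithm ι G E) (enc : D ↪ G) (x : ι → D) (e : E) : ℝ :=
  ∑ b with A.out b = e, ‖A.state enc x A.numQueries b‖ ^ 2

/-- On every input in its domain, the algorithm outputs the value of `f` with error at most `ε`. -/
def Computes [DecidableEq E] (A : Algorithm ι G E) (enc : D ↪ G) (ε : ℝ)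
    {𝒟 : Finset (ι → D)} (f : 𝒟 → E) : Prop :=
  ∀ x : 𝒟, 1 - ε ≤ A.outputProb enc x.1 (f x)

end Algorithm

/-- The quantum query complexity `Q_ε(f)`: the least number of queries of an algorithm that
computes `f` with error at most `ε` (it is `⊤` if there is no such algorithm). -/
def queryComplexity {ι D G E : Type*} [Fintype ι] [DecidableEq ι] [Fintype G] [DecidableEq G]
    [AddCommGroup G] [DecidableEq E] (enc : D ↪ G) (ε : ℝ) {𝒟 : Finset (ι → D)} (f : 𝒟 → E) :
    ℕ∞ :=
  ⨅ (A : Algorithm ι G E) (_ : A.Computes enc ε f), (A.numQueries : ℕ∞)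

/-! ### The additive adversary bound -/

/-- The all-ones matrix `J`. -/
def allOnes (X : Type*) : Matrix X X ℂ := Matrix.of fun _ _ => 1

/-- The target Gram matrix `F (x, y) = δ_{f x, f y}` of a function. -/
def gram {X E : Type*} [DecidableEq E] (f : X → E) : Matrix X X ℂ :=
  Matrix.of fun x y => if f x = f y then 1 else 0

/-- The matrix `Δ_i (x, y) = δ_{x_i, y_i}`. -/
def agree {ι D : Type*} [DecidableEq D] (𝒟 : Finset (ι → D)) (i : ι) : Matrix 𝒟 𝒟 ℂ :=
  Matrix.of fun x y => if x.1 i = y.1 i then 1 else 0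

/-- The spectral norm of a matrix. -/
def specNorm {X : Type*} [Fintype X] [DecidableEq X] (M : Matrix X X ℂ) : ℝ :=
  ‖Matrix.toEuclideanCLM (n := X) (𝕜 := ℂ) M‖

/-- `Γ` is an additive adversary matrix: it is Hermitian and `I ± Γ ∘ (J - Δ_i) ⪰ 0` for all `i`. -/
def IsAdversaryMatrix {ι D : Type*} [Fintype ι] [DecidableEq D] (𝒟 : Finset (ι → D))
    (Γ : Matrix 𝒟 𝒟 ℂ) : Prop :=
  Γ.IsHermitian ∧ ∀ i : ι,
    (1 + Γ ⊙ (allOnes 𝒟 - agree 𝒟 i)).PosSemidef ∧ (1 - Γ ⊙ (allOnes 𝒟 - agree 𝒟 i)).PosSemidef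

/-- The additive adversary bound of a target Gram matrix `σ`: the maximum of `‖Γ ∘ (J - σ)‖` over
all additive adversary matrices `Γ`. -/
def advBound {ι D : Type*} [Fintype ι] [DecidableEq D] {𝒟 : Finset (ι → D)}
    (σ : Matrix 𝒟 𝒟 ℂ) : ℝ≥0∞ :=
  ⨆ (Γ : Matrix 𝒟 𝒟 ℂ) (_ : IsAdversaryMatrix 𝒟 Γ),
    ENNReal.ofReal (specNorm (Γ ⊙ (allOnes 𝒟 - σ)))

end QuantumQuery

end

namespace QuantumQuery

open Finset

/-! ### Quadratic forms -/

/-! The proof is a multiplicative adversary argument built from an additive adversary matrix. Given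
`Γ`, put `A = Γ ∘ (J - F)` and `d = ‖A‖`. Up to sign, `H = A / d` has spectrum in `[-1, 1]`,
vanishes on pairs with equal function values, and fixes a unit vector `v`; moreover `H ∘ (J - Δ_i)`
lies between `± (2 / d) I` (`exists_normalized`). The matrix `S = 2 - H` then satisfies `S ⪰ I` and
`v* S v = 1`.

For the inputs weighted by `v^{⊗k}`, the potential defined by `S^{⊗k}` starts at `1`, and a query
multiplies it by at most `1 + 4 / d` (`isMultiplicative_tensor`,
`IsMultiplicative.potential_shift_le`). Run the algorithm, project on each output `e`, and run it
backwards: the amplitude of the start state at input `x` becomes the weight of `x` times the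
probability of `e`. Cauchy-Schwarz for `S^{⊗k}` and its inverse compares these vectors with the
restrictions of `v^{⊗k}` to the fibres of `f^(k)` (`Algorithm.sq_le_of_isMultiplicative`). With
success probability at least `η` and `T` queries, `η² ≤ (1 + 4 / d)^(2T) · (v* (S⁻¹ ∘ F) v)^k`. The
last factor is at most `(2 / 3)^k` (`quadForm_inv_hadamard_gram_le`). Taking `η = δ^(k/2)` and
logarithms gives the theorem. -/

theorem gram_posSemidef {X E : Type*} [DecidableEq E] (g : X → E) : (gram g).PosSemidef := by
  have : gram g = (1 : Matrix E E ℂ).submatrix g g := by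
    ext x y
    simp [gram, Matrix.one_apply]
  rw [this]
  exact Matrix.PosSemidef.one.submatrix g

section QuadForm

variable {X : Type*} [Fintype X]

/-- The real part of the quadratic form `u* M u`. -/
noncomputable def quadForm (M : Matrix X X ℂ) (u : X → ℂ) : ℝ :=
  (star u ⬝ᵥ (M *ᵥ u)).re

theorem quadForm_eq_sum (M : Matrix X X ℂ) (u : X → ℂ) :
    quadForm M u = (∑ x, ∑ y, M x y * (star (u x) * u y)).re := by
  simp only [quadForm, dotProduct, Matrix.mulVec, Finset.mul_sum, Pi.star_apply]
  congr 1
  exact Finset.sum_congr rfl fun x _ => Finset.sum_congr rfl fun y _ => by ring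

theorem quadForm_nonneg {M : Matrix X X ℂ} (hM : M.PosSemidef) (u : X → ℂ) :
    0 ≤ quadForm M u :=
  (Complex.le_def.mp (hM.dotProduct_mulVec_nonneg u)).1

@[simp]
theorem quadForm_zero (M : Matrix X X ℂ) : quadForm M 0 = 0 := by
  simp [quadForm]

theorem quadForm_add (M N : Matrix X X ℂ) (u : X → ℂ) :
    quadForm (M + N) u = quadForm M u + quadForm N u := by
  simp [quadForm, Matrix.add_mulVec]

theorem quadForm_sub (M N : Matrix X X ℂ) (u : X → ℂ) :
    quadForm (M - N) u = quadForm M u - quadForm N u := by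
  simp [quadForm, Matrix.sub_mulVec]

theorem quadForm_real_smul (c : ℝ) (M : Matrix X X ℂ) (u : X → ℂ) :
    quadForm (c • M) u = c * quadForm M u := by
  simp [quadForm, Matrix.smul_mulVec]

theorem quadForm_smul_right (M : Matrix X X ℂ) (c : ℝ) (u : X → ℂ) :
    quadForm M (c • u) = c ^ 2 * quadForm M u := by
  simp [quadForm, Matrix.mulVec_smul]
  ring

theorem quadForm_le {M N : Matrix X X ℂ} (h : (N - M).PosSemidef) (u : X → ℂ) :
    quadForm M u ≤ quadForm N u := by
  have := quadForm_nonneg h u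
  rw [quadForm_sub] at this
  linarith

/-- Cauchy-Schwarz for a positive semidefinite matrix and its inverse. -/
theorem two_mul_re_dotProduct_le [DecidableEq X] {M K : Matrix X X ℂ} (hM : M.PosSemidef)
    (hK : K.IsHermitian) (hMK : M * K = 1) (u t : X → ℂ) :
    2 * (star t ⬝ᵥ u).re ≤ quadForm M u + quadForm K t := by
  -- Expanding this square gives the claim, since `K = M⁻¹`.
  have h := quadForm_nonneg hM (u - K *ᵥ t)
  have h1 : M *ᵥ (K *ᵥ t) = t := by rw [Matrix.mulVec_mulVec, hMK, Matrix.one_mulVec]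
  have h2 : ∀ z, star (K *ᵥ t) ⬝ᵥ z = star t ⬝ᵥ (K *ᵥ z) := fun z => by
    rw [Matrix.star_mulVec, hK.eq, Matrix.dotProduct_mulVec]
  have hKM : K * M = 1 := mul_eq_one_comm.mp hMK
  have h3 : K *ᵥ (M *ᵥ u) = u := by rw [Matrix.mulVec_mulVec, hKM, Matrix.one_mulVec]
  have h4 : (star u ⬝ᵥ t).re = (star t ⬝ᵥ u).re := by
    rw [← Complex.conj_re (star t ⬝ᵥ u)]
    congr 1
    exact Matrix.star_dotProduct u t
  simp only [quadForm, Matrix.mulVec_sub, star_sub, sub_dotProduct, dotProduct_sub, h1, h2, h3,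
    Complex.sub_re, h4] at h ⊢
  linarith

/-- The product with `gram g` keeps exactly the diagonal blocks of `K` along the fibres of `g`. `S`
only makes the sum finite, as `E` need not be. -/
theorem quadForm_gram_hadamard {E : Type*} [DecidableEq E] (K : Matrix X X ℂ) (g : X → E)
    (S : Finset E) (hS : ∀ x, g x ∈ S) (w : X → ℂ) :
    ∑ e ∈ S, quadForm K (fun x => if g x = e then w x else 0) = quadForm (K ⊙ gram g) w := by
  simp only [quadForm_eq_sum, ← Complex.re_sum]
  congr 1
  rw [Finset.sum_comm]
  refine Finset.sum_congr rfl fun x _ => ?_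
  rw [Finset.sum_comm]
  refine Finset.sum_congr rfl fun y _ => ?_
  rw [Finset.sum_eq_single_of_mem (g x) (hS x)]
  · by_cases h : g x = g y <;> simp [gram, h, eq_comm]
  · intro e _ he
    simp [he.symm]

end QuadForm

/-! ### The potential of a family of states -/

section Potential

variable {X B : Type*} [Fintype X] [Fintype B]

/-- The potential `∑_b Φ(·, b)* M Φ(·, b)` of a family of states. -/
noncomputable def potential (M : Matrix X X ℂ) (Φ : X → B → ℂ) : ℝ :=
  ∑ b, quadForm M fun x => Φ x b

theorem potential_eq_sum (M : Matrix X X ℂ) (Φ : X → B → ℂ) :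
    potential M Φ = (∑ x, ∑ y, M x y * (star (Φ x) ⬝ᵥ Φ y)).re := by
  simp only [potential, quadForm_eq_sum, ← Complex.re_sum]
  congr 1
  rw [Finset.sum_comm]
  refine Finset.sum_congr rfl fun x _ => ?_
  rw [Finset.sum_comm]
  refine Finset.sum_congr rfl fun y _ => ?_
  simp [dotProduct, Finset.mul_sum]

/-- The potential sees the states only through their inner products, and only where `M` is nonzero.
Invariance under unitaries, and under shifts common to all inputs with the same answer, follows. -/
theorem potential_congr {C : Type*} [Fintype C] (M : Matrix X X ℂ) {Φ : X → B → ℂ}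
    {Ψ : X → C → ℂ}
    (h : ∀ x y, M x y = 0 ∨ star (Φ x) ⬝ᵥ Φ y = star (Ψ x) ⬝ᵥ Ψ y) :
    potential M Φ = potential M Ψ := by
  rw [potential_eq_sum, potential_eq_sum]
  congr 1
  refine Finset.sum_congr rfl fun x _ => Finset.sum_congr rfl fun y _ => ?_
  rcases h x y with h | h <;> simp [h]

theorem potential_mulVec [DecidableEq B] (M : Matrix X X ℂ) {U : Matrix B B ℂ} (hU : Uᴴ * U = 1)
    (Φ : X → B → ℂ) : potential M (fun x => U *ᵥ Φ x) = potential M Φ :=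
  potential_congr M fun x y => Or.inr <| by
    rw [Matrix.star_mulVec, Matrix.dotProduct_mulVec, Matrix.vecMul_vecMul, hU, Matrix.vecMul_one]

theorem potential_unitary_mulVec [DecidableEq B] (M : Matrix X X ℂ) (U : Matrix.unitaryGroup B ℂ)
    (Φ : X → B → ℂ) : potential M (fun x => U.1 *ᵥ Φ x) = potential M Φ :=
  potential_mulVec M (Matrix.mem_unitaryGroup_iff'.mp U.2) Φ

theorem potential_conjTranspose_mulVec [DecidableEq B] (M : Matrix X X ℂ)
    (U : Matrix.unitaryGroup B ℂ) (Φ : X → B → ℂ) :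
    potential M (fun x => U.1ᴴ *ᵥ Φ x) = potential M Φ :=
  potential_mulVec M (by
    rw [Matrix.conjTranspose_conjTranspose]; exact Matrix.mem_unitaryGroup_iff.mp U.2) Φ

theorem quadForm_le_potential {M : Matrix X X ℂ} (hM : M.PosSemidef) (Φ : X → B → ℂ) (b : B) :
    quadForm M (fun x => Φ x b) ≤ potential M Φ :=
  Finset.single_le_sum (f := fun b => quadForm M fun x => Φ x b)
    (fun _ _ => quadForm_nonneg hM _) (Finset.mem_univ b)

theorem sum_potential_project {E : Type*} [DecidableEq E] (M : Matrix X X ℂ) (Φ : X → B → ℂ)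
    (out : B → E) (S : Finset E) (hS : ∀ b, out b ∈ S) :
    ∑ e ∈ S, potential M (fun x b => if out b = e then Φ x b else 0) = potential M Φ := by
  simp only [potential]
  rw [Finset.sum_comm]
  refine Finset.sum_congr rfl fun b _ => ?_
  rw [Finset.sum_eq_single_of_mem (out b) (hS b)]
  · simp
  · intro e _ he
    simp only [he.symm, if_false]
    exact quadForm_zero M

/-- One query at a fixed position, in which states with the same answer are shifted alike,
increases the potential by at most the factor `1 + 2 κ`. -/
theorem potential_shift_le {A G : Type*} [DecidableEq A] [Fintype G] [AddGroup G]
    {M L : Matrix X X ℂ} {a : X → A} {κ : ℝ} (hκ : 0 ≤ κ)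
    (hL : ∀ x y, a x ≠ a y → L x y = 0) (hLM : (M - L).PosSemidef)
    (hadd : (κ • L + M ⊙ (allOnes X - gram a)).PosSemidef)
    (hsub : (κ • L - M ⊙ (allOnes X - gram a)).PosSemidef)
    (s : X → G) (hs : ∀ x y, a x = a y → s x = s y) (φ : X → G → ℂ) :
    potential M (fun x g => φ x (g - s x)) ≤ (1 + 2 * κ) * potential M φ := by
  set N := M ⊙ (allOnes X - gram a) with hN
  -- Both `M - N` and `L` are supported on pairs with equal answers, so the query does not change
  -- their potentials. Only the `N`-part moves, within `± κ` times the potential of `L`, hence by at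
  -- most `2 κ` times it.
  have invariant : ∀ R : Matrix X X ℂ, (∀ x y, a x ≠ a y → R x y = 0) →
      potential R (fun x g => φ x (g - s x)) = potential R φ := by
    intro R hR
    refine potential_congr R fun x y => ?_
    by_cases h : a x = a y
    · right
      simp only [dotProduct, Pi.star_apply, hs x y h]
      exact (Equiv.subRight (s y)).sum_comp fun g => star (φ x g) * φ y g
    · exact Or.inl (hR x y h)
  have hD := invariant (M - N) fun x y h => by simp [hN, allOnes, gram, h]
  have hL' := invariant L hL
  have split : ∀ ψ : X → G → ℂ, potential M ψ = potential (M - N) ψ + potential N ψ := by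
    intro ψ
    simp only [potential, ← Finset.sum_add_distrib, ← quadForm_add, sub_add_cancel]
  have up : ∀ ψ : X → G → ℂ, potential N ψ ≤ κ * potential L ψ := by
    intro ψ
    simp only [potential, Finset.mul_sum, ← quadForm_real_smul]
    exact Finset.sum_le_sum fun g _ => quadForm_le hsub _
  have down : ∀ ψ : X → G → ℂ, -(κ * potential L ψ) ≤ potential N ψ := by
    intro ψ
    simp only [potential, Finset.mul_sum, ← quadForm_real_smul, ← Finset.sum_neg_distrib]
    refine Finset.sum_le_sum fun g _ => ?_
    have := quadForm_nonneg hadd fun x => ψ x g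
    rw [quadForm_add] at this
    linarith
  have hle : potential L φ ≤ potential M φ :=
    Finset.sum_le_sum fun g _ => quadForm_le hLM _
  have h1 := split fun x g => φ x (g - s x)
  have h2 := split φ
  have h3 := up fun x g => φ x (g - s x)
  have h4 := down φ
  rw [hL'] at h3
  nlinarith [mul_le_mul_of_nonneg_left hle hκ]

end Potential

/-! ### Queries -/

section Query

variable {ι G : Type*} [AddCommGroup G] {m : ℕ}

/-- The operator `|i, b, w⟩ ↦ |i, b + s i, w⟩`, `|none, b, w⟩ ↦ |none, b, w⟩`. -/
def shift (s : ι → G) (ψ : Basis ι G m → ℂ) : Basis ι G m → ℂ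
  | (none, b, w) => ψ (none, b, w)
  | (some i, b, w) => ψ (some i, b - s i, w)

theorem query_eq_shift {D : Type*} (enc : D ↪ G) (x : ι → D) (ψ : Basis ι G m → ℂ) :
    query enc x ψ = shift (fun i => enc (x i)) ψ := by
  ext ⟨i | i, b, w⟩ <;> rfl

theorem shift_smul (s : ι → G) (c : ℂ) (ψ : Basis ι G m → ℂ) :
    shift s (c • ψ) = c • shift s ψ := by
  ext ⟨i | i, b, w⟩ <;> rfl

variable [Fintype ι] [Fintype G]

theorem star_shift_dotProduct (s : ι → G) (ψ φ : Basis ι G m → ℂ) :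
    star (shift s ψ) ⬝ᵥ φ = star ψ ⬝ᵥ shift (-s) φ := by
  simp only [dotProduct, Fintype.sum_prod_type, Fintype.sum_option, Pi.star_apply]
  refine congr_arg₂ _ rfl (Finset.sum_congr rfl fun i _ => ?_)
  rw [← Equiv.sum_comp (Equiv.addRight (s i))]
  simp [shift]

variable {X D : Type*} [Fintype X] [DecidableEq D]

/-- The conditions under which a query on inputs `a x` increases the potential by at most the
factor `1 + 2 κ`. -/
structure IsMultiplicative (a : X → ι → D) (κ : ℝ) (M : Matrix X X ℂ) : Prop where
  nonneg : 0 ≤ κ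
  posSemidef : M.PosSemidef
  -- `L` replaces the identity of the additive condition: it is unaffected by a query at `i`, and
  -- for tensor powers it retains the factors of the blocks not queried.
  exists_le (i : ι) : ∃ L : Matrix X X ℂ, (∀ x y, a x i ≠ a y i → L x y = 0) ∧
    (M - L).PosSemidef ∧ (κ • L + M ⊙ (allOnes X - gram fun x => a x i)).PosSemidef ∧
      (κ • L - M ⊙ (allOnes X - gram fun x => a x i)).PosSemidef

theorem IsMultiplicative.potential_shift_le {a : X → ι → D} {κ : ℝ} {M : Matrix X X ℂ}
    (h : IsMultiplicative a κ M) (s : X → ι → G) (hs : ∀ x y i, a x i = a y i → s x i = s y i)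
    (Φ : X → Basis ι G m → ℂ) :
    potential M (fun x => shift (s x) (Φ x)) ≤ (1 + 2 * κ) * potential M Φ := by
  -- For each index and workspace value, a query acts on the answer register alone; the `none` part
  -- is untouched.
  have decomp : ∀ Ψ : X → Basis ι G m → ℂ, potential M Ψ =
      potential M (fun x (p : G × Fin m) => Ψ x (none, p)) +
        ∑ i, ∑ w, potential M fun x g => Ψ x (some i, g, w) := by
    intro Ψ
    simp only [potential, Fintype.sum_prod_type, Fintype.sum_option]
    exact congr_arg _ (Finset.sum_congr rfl fun i _ => Finset.sum_comm)
  rw [decomp, decomp Φ, mul_add]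
  refine add_le_add ?_ ?_
  · have h0 : 0 ≤ potential M (fun x (p : G × Fin m) => Φ x (none, p)) :=
      Finset.sum_nonneg fun _ _ => quadForm_nonneg h.posSemidef _
    change potential M (fun x (p : G × Fin m) => Φ x (none, p)) ≤ _
    nlinarith [h.nonneg, mul_nonneg h.nonneg h0]
  · simp only [Finset.mul_sum]
    refine Finset.sum_le_sum fun i _ => Finset.sum_le_sum fun w _ => ?_
    obtain ⟨L, h1, h2, h3, h4⟩ := h.exists_le i
    exact QuantumQuery.potential_shift_le h.nonneg h1 h2 h3 h4 (fun x => s x i)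
      (fun x y => hs x y i) fun x g => Φ x (some i, g, w)

end Query

/-! ### Running an algorithm backwards -/

namespace Algorithm

variable {ι D G E : Type*} [Fintype ι] [DecidableEq ι] [Fintype G] [DecidableEq G]
  [AddCommGroup G]

/-- The adjoint of the first `t` queries of the algorithm. -/
def adjointRun (A : Algorithm ι G E) (enc : D ↪ G) (x : ι → D) :
    ℕ → (Basis ι G A.workDim → ℂ) → (Basis ι G A.workDim → ℂ)
  | 0, ψ => (A.U 0 : Matrix _ _ ℂ)ᴴ *ᵥ ψ
  | t + 1, ψ =>
    A.adjointRun enc x t (shift (-fun i => enc (x i)) ((A.U (t + 1) : Matrix _ _ ℂ)ᴴ *ᵥ ψ))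

theorem star_state_dotProduct (A : Algorithm ι G E) (enc : D ↪ G) (x : ι → D) (t : ℕ)
    (ψ : Basis ι G A.workDim → ℂ) :
    star (A.state enc x t) ⬝ᵥ ψ = A.adjointRun enc x t ψ A.start := by
  induction t generalizing ψ with
  | zero =>
    rw [state, Matrix.star_mulVec, ← Matrix.dotProduct_mulVec, adjointRun, ← Pi.single_star]
    simp
  | succ t ih =>
    rw [state, Matrix.star_mulVec, ← Matrix.dotProduct_mulVec, query_eq_shift,
      star_shift_dotProduct, ih, adjointRun]

/-- The amplitude of the initial state after the algorithm is run, its output `e` is recorded, and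
it is run backwards. -/
theorem adjointRun_project_start [DecidableEq E] (A : Algorithm ι G E) (enc : D ↪ G) (x : ι → D) (c : ℂ) (e : E) :
    A.adjointRun enc x A.numQueries
        (fun b => if A.out b = e then (c • A.state enc x A.numQueries) b else 0) A.start =
      c * A.outputProb enc x e := by
  rw [← star_state_dotProduct, outputProb, Finset.sum_filter, Complex.ofReal_sum, Finset.mul_sum,
    dotProduct]
  refine Finset.sum_congr rfl fun b _ => ?_
  split_ifs with hb
  · simp only [Pi.star_apply, Pi.smul_apply, smul_eq_mul, Complex.ofReal_pow]
    rw [← Complex.conj_mul', starRingEnd_apply]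
    ring
  · simp

variable {X : Type*} [Fintype X] [DecidableEq D]

theorem potential_state_le (A : Algorithm ι G E) (enc : D ↪ G) {a : X → ι → D} {κ : ℝ}
    {M : Matrix X X ℂ} (h : IsMultiplicative a κ M) (w : X → ℂ) (t : ℕ) :
    potential M (fun x => w x • A.state enc (a x) t) ≤ (1 + 2 * κ) ^ t * quadForm M w := by
  induction t with
  | zero =>
    simp only [state, ← Matrix.mulVec_smul, pow_zero, one_mul]
    rw [potential_unitary_mulVec M, potential,
      Finset.sum_eq_single_of_mem A.start (Finset.mem_univ _)]
    · simp
    · intro b _ hb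
      simp only [Pi.smul_apply, Pi.single_eq_of_ne hb, smul_zero]
      exact quadForm_zero M
  | succ t ih =>
    simp only [state, ← Matrix.mulVec_smul]
    rw [potential_unitary_mulVec M]
    simp only [query_eq_shift, ← shift_smul]
    refine (h.potential_shift_le (fun x i => enc (a x i)) (fun x y i hxy => by simp [hxy])
      _).trans ?_
    rw [pow_succ', mul_assoc]
    exact mul_le_mul_of_nonneg_left ih (by linarith [h.nonneg])

theorem potential_adjointRun_le (A : Algorithm ι G E) (enc : D ↪ G) {a : X → ι → D} {κ : ℝ}
    {M : Matrix X X ℂ} (h : IsMultiplicative a κ M) (t : ℕ)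
    (Φ : X → Basis ι G A.workDim → ℂ) :
    potential M (fun x => A.adjointRun enc (a x) t (Φ x)) ≤
      (1 + 2 * κ) ^ t * potential M Φ := by
  induction t generalizing Φ with
  | zero =>
    simp only [adjointRun]
    rw [potential_conjTranspose_mulVec M, pow_zero, one_mul]
  | succ t ih =>
    simp only [adjointRun]
    refine (ih _).trans ?_
    rw [pow_succ, mul_assoc]
    refine mul_le_mul_of_nonneg_left ?_ (pow_nonneg (by linarith [h.nonneg]) t)
    refine (h.potential_shift_le (fun x => -fun i => enc (a x i))
      (fun x y i hxy => by simp [hxy]) _).trans ?_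
    rw [potential_conjTranspose_mulVec M]

/-- The multiplicative adversary method for algorithms that compute a function. -/
theorem sq_le_of_isMultiplicative [DecidableEq X] [DecidableEq E] (A : Algorithm ι G E) (enc : D ↪ G)
    {a : X → ι → D} {κ : ℝ} {M K : Matrix X X ℂ} (h : IsMultiplicative a κ M)
    (hK : K.PosSemidef) (hMK : M * K = 1) (g : X → E) {η : ℝ} (hη : 0 ≤ η)
    (hA : ∀ x, η ≤ A.outputProb enc (a x) (g x)) (w : X → ℂ) (hw : ∑ x, ‖w x‖ ^ 2 = 1) :
    η ^ 2 ≤ (1 + 2 * κ) ^ (2 * A.numQueries) * quadForm M w * quadForm (K ⊙ gram g) w := by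
  classical
  set S : Finset E := univ.image A.out ∪ univ.image g
  have hout : ∀ b, A.out b ∈ S := fun b => by simp [S]
  have hg : ∀ x, g x ∈ S := fun x => by simp [S]
  set u : E → X → ℂ := fun e x => w x * A.outputProb enc (a x) e
  set t : E → X → ℂ := fun e x => if g x = e then w x else 0
  set W := ∑ e ∈ S, quadForm M (u e)
  set Q := quadForm (K ⊙ gram g) w
  have hr : 0 ≤ 1 + 2 * κ := by linarith [h.nonneg]
  -- The exponent doubles because both the forward and the backward run cost queries. The
  -- projections on the outputs split the potential exactly, and positivity of `M` allows all
  -- amplitudes except that of `A.start` to be dropped.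
  have hW : W ≤ (1 + 2 * κ) ^ (2 * A.numQueries) * quadForm M w := by
    calc W ≤ ∑ e ∈ S, (1 + 2 * κ) ^ A.numQueries * potential M (fun x b =>
          if A.out b = e then (w x • A.state enc (a x) A.numQueries) b else 0) := by
          refine Finset.sum_le_sum fun e _ => ?_
          simp only [u, ← adjointRun_project_start]
          exact (quadForm_le_potential h.posSemidef (fun x => A.adjointRun enc (a x) A.numQueries
            (fun b => if A.out b = e then (w x • A.state enc (a x) A.numQueries) b else 0)) _).trans
            (A.potential_adjointRun_le enc h A.numQueries _)
      _ = (1 + 2 * κ) ^ A.numQueries * potential M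
          (fun x => w x • A.state enc (a x) A.numQueries) := by
          rw [← Finset.mul_sum,
            sum_potential_project M (fun x => w x • A.state enc (a x) A.numQueries) A.out S hout]
      _ ≤ (1 + 2 * κ) ^ A.numQueries * ((1 + 2 * κ) ^ A.numQueries * quadForm M w) :=
          mul_le_mul_of_nonneg_left (A.potential_state_le enc h w _) (pow_nonneg hr _)
      _ = _ := by ring
  have hQ : ∑ e ∈ S, quadForm K (t e) = Q := quadForm_gram_hadamard K g S hg w
  have hdot : η ≤ ∑ e ∈ S, (star (t e) ⬝ᵥ u e).re := by
    have : ∑ e ∈ S, (star (t e) ⬝ᵥ u e).re =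
        ∑ x, ‖w x‖ ^ 2 * A.outputProb enc (a x) (g x) := by
      simp only [dotProduct, Complex.re_sum]
      rw [Finset.sum_comm]
      refine Finset.sum_congr rfl fun x _ => ?_
      rw [Finset.sum_eq_single_of_mem (g x) (hg x)]
      · simp only [t, u, Pi.star_apply, if_true]
        rw [← mul_assoc, ← starRingEnd_apply, Complex.conj_mul', ← Complex.ofReal_pow,
          ← Complex.ofReal_mul, Complex.ofReal_re]
      · intro e _ he
        simp [t, he.symm]
    rw [this, ← one_mul η, ← hw, Finset.sum_mul]
    exact Finset.sum_le_sum fun x _ => mul_le_mul_of_nonneg_left (hA x) (sq_nonneg _)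
  -- Scaling `t e` by `s` leaves one free parameter; `s = η / Q` turns the bound into `η² ≤ W Q`. If
  -- `Q = 0 < η`, a large `s` gives a contradiction.
  have hquad : ∀ s : ℝ, 0 ≤ s → 2 * s * η ≤ W + s ^ 2 * Q := by
    intro s hs
    have hsum : ∑ e ∈ S, 2 * (star (s • t e) ⬝ᵥ u e).re ≤ W + s ^ 2 * Q := by
      rw [← hQ, Finset.mul_sum, ← Finset.sum_add_distrib]
      refine Finset.sum_le_sum fun e _ => ?_
      rw [← quadForm_smul_right]
      exact two_mul_re_dotProduct_le h.posSemidef hK.isHermitian hMK _ _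
    refine le_trans ?_ hsum
    simp only [star_smul, smul_dotProduct, ← Finset.mul_sum]
    simp only [star_trivial, Complex.real_smul, Complex.re_ofReal_mul, ← Finset.mul_sum]
    nlinarith [mul_le_mul_of_nonneg_left hdot hs]
  have hQ0 : 0 ≤ Q := quadForm_nonneg (hK.hadamard (gram_posSemidef g)) w
  refine le_trans ?_ (mul_le_mul_of_nonneg_right hW hQ0)
  have hW0 : 0 ≤ W := Finset.sum_nonneg fun e _ => quadForm_nonneg h.posSemidef _
  rcases hQ0.eq_or_lt with h0 | hpos
  · rcases hη.eq_or_lt with h1 | h1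
    · simp [← h1, ← h0]
    · have := hquad ((W + 1) / η) (by positivity)
      rw [← h0, mul_assoc, div_mul_cancel₀ _ h1.ne'] at this
      linarith
  · have := hquad (η / Q) (by positivity)
    field_simp at this
    linarith

end Algorithm

/-! ### Tensor products of matrices -/

section Tensor

variable {P X : Type*} [Fintype P]

/-- The tensor product of a family of matrices. -/
def tensor (M : P → Matrix X X ℂ) : Matrix (P → X) (P → X) ℂ :=
  Matrix.of fun x y => ∏ p, M p (x p) (y p)

theorem tensor_hadamard (M N : P → Matrix X X ℂ) :
    tensor M ⊙ tensor N = tensor fun p => M p ⊙ N p := by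
  ext x y
  simp [tensor, Finset.prod_mul_distrib]

theorem tensor_update [DecidableEq P] (M : P → Matrix X X ℂ) (p : P) (A : Matrix X X ℂ)
    (x y : P → X) :
    tensor (Function.update M p A) x y =
      A (x p) (y p) * ∏ q ∈ univ.erase p, M q (x q) (y q) := by
  simp only [tensor, Matrix.of_apply]
  rw [← Finset.mul_prod_erase univ _ (Finset.mem_univ p), Function.update_self]
  refine congr_arg _ (Finset.prod_congr rfl fun q hq => ?_)
  rw [Function.update_of_ne (Finset.ne_of_mem_erase hq)]

theorem tensor_gram {E : Type*} [DecidableEq E] (f : X → E) :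
    tensor (fun _ : P => gram f) = gram fun x p => f (x p) := by
  ext x y
  simp only [tensor, gram, Matrix.of_apply, Finset.prod_ite_zero, Finset.prod_const_one,
    Finset.mem_univ, true_imp_iff, funext_iff]

theorem tensor_one [DecidableEq X] : tensor (fun _ : P => (1 : Matrix X X ℂ)) = 1 := by
  ext x y
  simp only [tensor, Matrix.one_apply, Matrix.of_apply, Finset.prod_ite_zero,
    Finset.prod_const_one, Finset.mem_univ, true_imp_iff, funext_iff]

/-- A tensor product is the entrywise product of the pullbacks of its factors, so the Schur product
theorem applies. -/
theorem tensor_posSemidef {M : P → Matrix X X ℂ} (hM : ∀ p, (M p).PosSemidef) :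
    (tensor M).PosSemidef := by
  classical
  suffices ∀ s : Finset P, (Matrix.of fun x y : P → X => ∏ p ∈ s, M p (x p) (y p)).PosSemidef from
    this univ
  intro s
  induction s using Finset.induction_on with
  | empty =>
    convert gram_posSemidef fun _ : P → X => () using 1
    ext x y
    simp [gram]
  | insert p s hp ih =>
    have : (Matrix.of fun x y : P → X => ∏ q ∈ insert p s, M q (x q) (y q)) =
        (M p).submatrix (fun x => x p) (fun x => x p) ⊙
          Matrix.of fun x y => ∏ q ∈ s, M q (x q) (y q) := by
      ext x y
      simp [Finset.prod_insert hp]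
    rw [this]
    exact ((hM p).submatrix fun x : P → X => x p).hadamard ih

variable [Fintype X] [DecidableEq P]

theorem tensor_mul (M N : P → Matrix X X ℂ) :
    tensor M * tensor N = tensor fun p => M p * N p := by
  ext x y
  simp only [tensor, Matrix.mul_apply, Matrix.of_apply, ← Finset.prod_mul_distrib]
  rw [Finset.prod_univ_sum, Fintype.piFinset_univ]

theorem sum_norm_prod_sq (v : X → ℂ) :
    ∑ x : P → X, ‖∏ p, v (x p)‖ ^ 2 = (∑ x, ‖v x‖ ^ 2) ^ Fintype.card P := by
  simp only [norm_prod, ← Finset.prod_pow]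
  rw [← Finset.card_univ, ← Finset.prod_const, Finset.prod_univ_sum, Fintype.piFinset_univ]

theorem quadForm_tensor {M : Matrix X X ℂ} (hM : M.PosSemidef) (v : X → ℂ) :
    quadForm (tensor fun _ : P => M) (fun x => ∏ p, v (x p)) =
      quadForm M v ^ Fintype.card P := by
  -- The form is real on a positive semidefinite matrix, so taking its real part commutes with the
  -- power.
  have hz : star v ⬝ᵥ (M *ᵥ v) = (quadForm M v : ℂ) :=
    (Complex.ext (by simp [quadForm])
      (by simpa using (Complex.le_def.mp (hM.dotProduct_mulVec_nonneg v)).2.symm))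
  have hmul : (tensor fun _ : P => M) *ᵥ (fun x => ∏ p, v (x p)) =
      fun x => ∏ p, (M *ᵥ v) (x p) := by
    ext x
    simp only [Matrix.mulVec, dotProduct, tensor, Matrix.of_apply, ← Finset.prod_mul_distrib]
    rw [Finset.prod_univ_sum, Fintype.piFinset_univ]
  have hdot : star (fun x : P → X => ∏ p, v (x p)) ⬝ᵥ (fun x => ∏ p, (M *ᵥ v) (x p)) =
      (star v ⬝ᵥ (M *ᵥ v)) ^ Fintype.card P := by
    simp only [dotProduct, Pi.star_apply, star_prod, ← Finset.prod_mul_distrib]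
    rw [← Finset.card_univ, ← Finset.prod_const, Finset.prod_univ_sum, Fintype.piFinset_univ]
  rw [quadForm, hmul, hdot, hz, ← Complex.ofReal_pow, Complex.ofReal_re]

end Tensor

/-! ### From additive to multiplicative adversary matrices -/

section Additive

variable {X : Type*} [Fintype X] [DecidableEq X]

open scoped Matrix.Norms.L2Operator MatrixOrder in
theorem posSemidef_specNorm_sub {A : Matrix X X ℂ} (hA : A.IsHermitian) :
    (specNorm A • (1 : Matrix X X ℂ) - A).PosSemidef := by
  have h : A ≤ algebraMap ℝ _ ‖A‖ := IsSelfAdjoint.le_algebraMap_norm_self (ha := hA)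
  rw [Matrix.le_iff, Algebra.algebraMap_eq_smul_one] at h
  exact h

theorem specNorm_neg (A : Matrix X X ℂ) : specNorm (-A) = specNorm A := by
  simp [specNorm]

theorem posSemidef_specNorm_add {A : Matrix X X ℂ} (hA : A.IsHermitian) :
    (specNorm A • (1 : Matrix X X ℂ) + A).PosSemidef := by
  simpa [specNorm_neg] using posSemidef_specNorm_sub hA.neg

open scoped Matrix.Norms.L2Operator MatrixOrder in
theorem specNorm_mem_spectrum [Nonempty X] {A : Matrix X X ℂ} (hA : A.IsHermitian) :
    specNorm A ∈ spectrum ℝ A ∨ -specNorm A ∈ spectrum ℝ A :=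
  CStarAlgebra.norm_or_neg_norm_mem_spectrum hA

theorem exists_mulVec_eq_of_mem_spectrum {A : Matrix X X ℂ} {r : ℝ} (hr : r ∈ spectrum ℝ A) :
    ∃ v, star v ⬝ᵥ v = 1 ∧ A *ᵥ v = r • v := by
  rw [spectrum.mem_iff, Matrix.isUnit_iff_isUnit_det, isUnit_iff_ne_zero, not_not,
    ← Matrix.exists_mulVec_eq_zero_iff] at hr
  obtain ⟨v, hv, hrv⟩ := hr
  have hAv : A *ᵥ v = r • v := by
    rw [Matrix.sub_mulVec, sub_eq_zero, Algebra.algebraMap_eq_smul_one, Matrix.smul_mulVec,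
      Matrix.one_mulVec] at hrv
    exact hrv.symm
  have hsum : star v ⬝ᵥ v = ((∑ x, ‖v x‖ ^ 2 : ℝ) : ℂ) := by
    simp [dotProduct, ← Complex.conj_mul']
  have hpos : 0 < ∑ x, ‖v x‖ ^ 2 := by
    obtain ⟨x, hx⟩ := Function.ne_iff.mp hv
    exact Finset.sum_pos' (fun _ _ => sq_nonneg _) ⟨x, Finset.mem_univ x, by
      have : 0 < ‖v x‖ := norm_pos_iff.mpr hx
      positivity⟩
  set c := (Real.sqrt (∑ x, ‖v x‖ ^ 2))⁻¹ with hc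
  refine ⟨c • v, ?_, by rw [Matrix.mulVec_smul, hAv, smul_comm]⟩
  have hcc : c * c * ∑ x, ‖v x‖ ^ 2 = 1 := by
    rw [hc, ← mul_inv, Real.mul_self_sqrt hpos.le, inv_mul_cancel₀ hpos.ne']
  rw [star_smul, smul_dotProduct, dotProduct_smul, hsum, smul_smul, star_trivial,
    Complex.real_smul, ← Complex.ofReal_mul, hcc, Complex.ofReal_one]

/-- On `[-1, 1]` the convex function `1 / (2 - h)` lies below its chord `(2 + h) / 3`, hence `(2 -
H)⁻¹ ⪯ (2 + H) / 3`. The entrywise product with `gram f` preserves this and removes `H`, leaving `(2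
/ 3) I`. -/
theorem quadForm_inv_hadamard_gram_le {E : Type*} [DecidableEq E] (f : X → E)
    {H : Matrix X X ℂ} (hsub : (1 - H).PosSemidef) (hadd : (1 + H).PosSemidef)
    (hf : H ⊙ gram f = 0) {v : X → ℂ} (hv : star v ⬝ᵥ v = 1) :
    quadForm ((2 - H)⁻¹ ⊙ gram f) v ≤ 2 / 3 := by
  set S := 2 - H with hS
  have hSdef : S.PosDef := by
    have : S = 1 + (1 - H) := by rw [hS, ← add_sub_assoc, one_add_one_eq_two]
    rw [this]
    exact Matrix.PosDef.one.add_posSemidef hsub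
  have hunit : IsUnit S.det := (Matrix.isUnit_iff_isUnit_det S).mp hSdef.isUnit
  have hKS : S⁻¹ * S = 1 := Matrix.nonsing_inv_mul S hunit
  have hSK : S * S⁻¹ = 1 := Matrix.mul_nonsing_inv S hunit
  have hK : S⁻¹.IsHermitian := hSdef.isHermitian.inv
  set K := S⁻¹
  -- The matrix equals `(2 - H)(1 - H²)`; writing `2 - H = ((1 + H) + 3 (1 - H)) / 2` exhibits it as
  -- a sum of congruences of `1 ± H`.
  have hQ : (S * (2 + H) * S - 3 * S).PosSemidef := by
    have : S * (2 + H) * S - 3 * S = (1 / 2 : ℝ) • ((1 + H) * (1 - H) * (1 + H)ᴴ +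
        (3 : ℝ) • ((1 - H) * (1 + H) * (1 - H)ᴴ)) := by
      rw [hadd.isHermitian.eq, hsub.isHermitian.eq, hS]
      have h3 : ∀ Y : Matrix X X ℂ, (3 : ℝ) • Y = Y + Y + Y := fun Y => by module
      have h2 : ∀ Y Z : Matrix X X ℂ, Y + Y = Z → Y = (1 / 2 : ℝ) • Z := fun Y Z h => by
        rw [← h]; module
      rw [h3, show (2 : Matrix X X ℂ) = 1 + 1 from one_add_one_eq_two.symm]
      apply h2
      noncomm_ring
    rw [this]
    exact ((hsub.mul_mul_conjTranspose_same _).add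
      ((hadd.mul_mul_conjTranspose_same _).smul (by norm_num))).smul (by norm_num)
  have hconj : K * (S * (2 + H) * S - 3 * S) * Kᴴ = (2 + H) - (3 : ℝ) • K := by
    have h3 : (3 : Matrix X X ℂ) * S = (3 : ℝ) • S := by
      have h3' : (3 : ℝ) • S = S + S + S := by module
      rw [h3']
      noncomm_ring
    rw [hK.eq, h3, mul_sub, sub_mul, mul_smul_comm, hKS, smul_mul_assoc, one_mul, ← mul_assoc,
      ← mul_assoc, hKS, one_mul, mul_assoc, hSK, mul_one]
  have hle := quadForm_nonneg
    ((hconj ▸ hQ.mul_mul_conjTranspose_same K).hadamard (gram_posSemidef f)) v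
  have heq : ((2 + H) - (3 : ℝ) • K) ⊙ gram f = (2 : ℝ) • (1 : Matrix X X ℂ) -
      (3 : ℝ) • (K ⊙ gram f) := by
    ext x y
    have hxy := congr_fun (congr_fun hf x) y
    by_cases h : x = y
    · subst h
      simp only [gram, Matrix.hadamard_apply, Matrix.of_apply, if_true, mul_one,
        Matrix.zero_apply] at hxy
      simp [gram, hxy, Matrix.ofNat_apply]
    · simp only [Matrix.hadamard_apply, Matrix.zero_apply] at hxy
      simp only [Matrix.hadamard_apply, Matrix.sub_apply, Matrix.add_apply, sub_mul, add_mul, hxy]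
      simp [h, Matrix.ofNat_apply, mul_assoc]
  rw [heq, quadForm_sub, quadForm_real_smul, quadForm_real_smul] at hle
  have hone : quadForm 1 v = 1 := by simp [quadForm, hv]
  linarith

/-- An additive adversary matrix, normalized so that it vanishes on pairs with equal function
values and has the top eigenvalue `1`. -/
theorem exists_normalized {ι D E : Type*} [Fintype ι] [DecidableEq D] [DecidableEq E]
    {𝒟 : Finset (ι → D)} (f : 𝒟 → E) {Γ : Matrix 𝒟 𝒟 ℂ} (hΓ : IsAdversaryMatrix 𝒟 Γ)
    (hd : 0 < specNorm (Γ ⊙ (allOnes 𝒟 - gram f))) :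
    ∃ (H : Matrix 𝒟 𝒟 ℂ) (v : 𝒟 → ℂ), (1 - H).PosSemidef ∧ (1 + H).PosSemidef ∧
      H ⊙ gram f = 0 ∧ star v ⬝ᵥ v = 1 ∧ H *ᵥ v = v ∧ ∀ i,
        ((2 / specNorm (Γ ⊙ (allOnes 𝒟 - gram f))) • (1 : Matrix 𝒟 𝒟 ℂ) +
          H ⊙ (allOnes 𝒟 - agree 𝒟 i)).PosSemidef ∧
        ((2 / specNorm (Γ ⊙ (allOnes 𝒟 - gram f))) • (1 : Matrix 𝒟 𝒟 ℂ) -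
          H ⊙ (allOnes 𝒟 - agree 𝒟 i)).PosSemidef := by
  set A := Γ ⊙ (allOnes 𝒟 - gram f) with hAdef
  set d := specNorm A with hddef
  have hF := gram_posSemidef f
  have hJ : (allOnes 𝒟).IsHermitian := by
    ext x y
    simp [allOnes]
  have hA : A.IsHermitian := hΓ.1.hadamard (hJ.sub hF.isHermitian)
  have : Nonempty 𝒟 := by
    by_contra hne
    rw [not_nonempty_iff] at hne
    rw [hddef, Subsingleton.elim A 0] at hd
    simp [specNorm] at hd
  have hAF : A ⊙ gram f = 0 := by
    ext x y
    by_cases h : f x = f y <;> simp [hAdef, gram, allOnes, h]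
  -- Removing the pairs with equal function values costs a factor `2`: the removed part is `N ∘ F`,
  -- and `I ± N ∘ F ⪰ 0` by the Schur product theorem, as `F` has unit diagonal.
  have key : ∀ i, ((2 : ℝ) • (1 : Matrix 𝒟 𝒟 ℂ) + A ⊙ (allOnes 𝒟 - agree 𝒟 i)).PosSemidef ∧
      ((2 : ℝ) • (1 : Matrix 𝒟 𝒟 ℂ) - A ⊙ (allOnes 𝒟 - agree 𝒟 i)).PosSemidef := by
    intro i
    obtain ⟨h1, h2⟩ := hΓ.2 i
    set N := Γ ⊙ (allOnes 𝒟 - agree 𝒟 i) with hN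
    have e0 : A ⊙ (allOnes 𝒟 - agree 𝒟 i) = N - N ⊙ gram f := by
      ext x y
      simp only [hAdef, hN, Matrix.hadamard_apply, Matrix.sub_apply, allOnes, Matrix.of_apply]
      ring
    have e1 : (1 : Matrix 𝒟 𝒟 ℂ) ⊙ gram f = 1 := by
      ext x y
      by_cases h : x = y <;> simp [h, gram, Matrix.one_apply]
    have h1F := h1.hadamard hF
    have h2F := h2.hadamard hF
    rw [Matrix.add_hadamard, e1] at h1F
    have e2 : (1 - N) ⊙ gram f = 1 - N ⊙ gram f := by
      rw [← e1]
      ext x y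
      by_cases h : f x = f y <;> simp [gram, h]
    rw [e2] at h2F
    rw [e0]
    constructor
    · convert h1.add h2F using 1
      module
    · convert h2.add h1F using 1
      module
  -- The norm may be attained only at the eigenvalue `-d`. The sign `c` is absorbed into `H`, which
  -- is harmless because all the bounds are symmetric.
  obtain ⟨c, hc, hcs⟩ : ∃ c : ℝ, (c = 1 ∨ c = -1) ∧ c * d ∈ spectrum ℝ A := by
    rcases specNorm_mem_spectrum hA with h | h
    · exact ⟨1, Or.inl rfl, by rwa [one_mul]⟩
    · exact ⟨-1, Or.inr rfl, by rwa [neg_one_mul]⟩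
  obtain ⟨v, hv, hAv⟩ := exists_mulVec_eq_of_mem_spectrum hcs
  have hscale : ∀ (r : ℝ) (Y : Matrix 𝒟 𝒟 ℂ), (r • (1 : Matrix 𝒟 𝒟 ℂ) + Y).PosSemidef →
      (r • (1 : Matrix 𝒟 𝒟 ℂ) - Y).PosSemidef →
      ((r / d) • (1 : Matrix 𝒟 𝒟 ℂ) + (c / d) • Y).PosSemidef ∧
        ((r / d) • (1 : Matrix 𝒟 𝒟 ℂ) - (c / d) • Y).PosSemidef := by
    intro r Y h1 h2
    have h1' := h1.smul (a := d⁻¹) (by positivity)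
    have h2' := h2.smul (a := d⁻¹) (by positivity)
    rcases hc with rfl | rfl
    · constructor
      · convert h1' using 1
        module
      · convert h2' using 1
        module
    · constructor
      · convert h2' using 1
        module
      · convert h1' using 1
        module
  have hself := hscale d A (posSemidef_specNorm_add hA) (posSemidef_specNorm_sub hA)
  rw [div_self hd.ne', one_smul] at hself
  refine ⟨(c / d) • A, v, hself.2, hself.1, ?_, hv, ?_, fun i => ?_⟩
  · rw [Matrix.smul_hadamard, hAF, smul_zero]
  · rw [Matrix.smul_mulVec, hAv, smul_smul]
    have : c / d * (c * d) = 1 := by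
      have : c / d * (c * d) = c * c := by field_simp
      rw [this]
      rcases hc with rfl | rfl <;> norm_num
    rw [this, one_smul]
  · rw [Matrix.smul_hadamard]
    exact hscale 2 _ (key i).1 (key i).2

end Additive

/-! ### The strong direct product theorem -/

section DirectProduct

variable {ι D : Type*} [Fintype ι] [DecidableEq D] {𝒟 : Finset (ι → D)}

/-- Tensor powers of multiplicative adversary matrices. -/
theorem isMultiplicative_tensor {κ : ℝ} (hκ : 0 ≤ κ) (k : ℕ) {S : Matrix 𝒟 𝒟 ℂ}
    (hS : (S - 1).PosSemidef)
    (h : ∀ i, (κ • (1 : Matrix 𝒟 𝒟 ℂ) + S ⊙ (allOnes 𝒟 - agree 𝒟 i)).PosSemidef ∧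
      (κ • (1 : Matrix 𝒟 𝒟 ℂ) - S ⊙ (allOnes 𝒟 - agree 𝒟 i)).PosSemidef) :
    IsMultiplicative (fun (y : Fin k → 𝒟) (q : Fin k × ι) => (y q.1).1 q.2) κ
      (tensor fun _ => S) := by
  have hS0 : S.PosSemidef := by simpa using hS.add Matrix.PosSemidef.one
  refine ⟨hκ, tensor_posSemidef fun _ => hS0, fun ⟨p, i⟩ => ?_⟩
  have hup : ∀ {B : Matrix 𝒟 𝒟 ℂ}, B.PosSemidef →
      (tensor (Function.update (fun _ : Fin k => S) p B)).PosSemidef := by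
    intro B hB
    refine tensor_posSemidef fun q => ?_
    by_cases hq : q = p
    · subst hq
      simpa using hB
    · simpa [hq] using hS0
  have hT : tensor (fun _ : Fin k => S) = tensor (Function.update (fun _ => S) p S) := by
    rw [Function.update_eq_self p (fun _ : Fin k => S)]
  -- With the identity in the queried block `p`, each condition becomes positivity of a tensor
  -- product whose factor at `p` is `S - 1` or `κ I ± S ∘ (J - Δ_i)`.
  refine ⟨tensor (Function.update (fun _ => S) p 1), fun x y hxy => ?_, ?_, ?_, ?_⟩
  · have : x p ≠ y p := fun h => hxy (by simp [h])
    rw [tensor_update, Matrix.one_apply_ne this, zero_mul]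
  · convert hup hS using 1
    ext x y
    rw [hT]
    simp only [Matrix.sub_apply, tensor_update]
    ring
  · convert hup (h i).1 using 1
    ext x y
    rw [hT]
    simp only [Matrix.add_apply, Matrix.smul_apply, Matrix.hadamard_apply, tensor_update,
      Complex.real_smul, Matrix.sub_apply, allOnes, gram, agree, Matrix.of_apply]
    ring
  · convert hup (h i).2 using 1
    ext x y
    rw [hT]
    simp only [Matrix.smul_apply, Matrix.hadamard_apply, tensor_update,
      Complex.real_smul, Matrix.sub_apply, allOnes, gram, agree, Matrix.of_apply]
    ring

variable [DecidableEq ι]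

/-- The multiplicative adversary bound for an algorithm computing `k` copies of a function. -/
theorem pow_le_of_computes {E G : Type*} [Fintype D] [DecidableEq E] [Fintype G] [DecidableEq G]
    [AddCommGroup G] (enc : D ↪ G) (f : 𝒟 → E) {Γ : Matrix 𝒟 𝒟 ℂ}
    (hΓ : IsAdversaryMatrix 𝒟 Γ) (hd : 0 < specNorm (Γ ⊙ (allOnes 𝒟 - gram f)))
    {k : ℕ} {η : ℝ} (hη : 0 ≤ η) (A : Algorithm (Fin k × ι) G (Fin k → E))
    (hA : A.Computes enc (1 - η) (funPow k f)) :
    η ^ 2 ≤ (1 + 2 * (2 / specNorm (Γ ⊙ (allOnes 𝒟 - gram f)))) ^ (2 * A.numQueries) *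
      (2 / 3) ^ k := by
  obtain ⟨H, v, hsub, hadd, hHf, hv, hHv, hH⟩ := exists_normalized f hΓ hd
  set d := specNorm (Γ ⊙ (allOnes 𝒟 - gram f))
  have hS1 : 2 - H - 1 = 1 - H := by
    rw [sub_right_comm, sub_left_inj, ← one_add_one_eq_two, add_sub_cancel_right]
  have hSdef : (2 - H).PosDef := by
    have : 2 - H = 1 + (1 - H) := by rw [← hS1, add_sub_cancel]
    rw [this]
    exact Matrix.PosDef.one.add_posSemidef hsub
  -- `J - Δ_i` has zero diagonal, so the summand `2` disappears.
  have hSN : ∀ i, (2 - H) ⊙ (allOnes 𝒟 - agree 𝒟 i) = -(H ⊙ (allOnes 𝒟 - agree 𝒟 i)) := by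
    intro i
    ext x y
    by_cases h : x = y
    · simp [h, allOnes, agree]
    · simp [h, Matrix.ofNat_apply]
  have hmult : IsMultiplicative (fun (y : Fin k → 𝒟) (q : Fin k × ι) => (y q.1).1 q.2) (2 / d)
      (tensor fun _ => 2 - H) := by
    refine isMultiplicative_tensor (by positivity) k (hS1 ▸ hsub) fun i => ?_
    rw [hSN]
    exact ⟨by simpa [sub_eq_add_neg] using (hH i).2, by simpa using (hH i).1⟩
  have hunit : IsUnit (2 - H).det := (Matrix.isUnit_iff_isUnit_det _).mp hSdef.isUnit
  have hw : ∑ x : Fin k → 𝒟, ‖∏ p, v (x p)‖ ^ 2 = 1 := by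
    have : ((∑ x, ‖v x‖ ^ 2 : ℝ) : ℂ) = 1 := by
      rw [← hv]
      simp [dotProduct, ← Complex.conj_mul']
    rw [sum_norm_prod_sq, Complex.ofReal_eq_one.mp this, one_pow]
  have hK := hSdef.inv.posSemidef
  have hmain := A.sq_le_of_isMultiplicative enc hmult
    (tensor_posSemidef fun _ : Fin k => hK) (by
      rw [tensor_mul, Matrix.mul_nonsing_inv _ hunit, tensor_one])
    (fun y p => f (y p)) hη (fun y => by
      have := hA ⟨fun q => (y q.1).1 q.2, by simp [powDomain]⟩
      rw [sub_sub_cancel] at this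
      exact this) _ hw
  rw [← tensor_gram, tensor_hadamard, quadForm_tensor hSdef.posSemidef,
    quadForm_tensor (hK.hadamard (gram_posSemidef f)), Fintype.card_fin] at hmain
  -- `v` is an eigenvector of `2 - H` for its least eigenvalue `1`, so the initial potential is `1`.
  have hone : quadForm (2 - H) v = 1 := by
    have h2 : (2 : Matrix 𝒟 𝒟 ℂ) *ᵥ v = v + v := by
      rw [← one_add_one_eq_two, Matrix.add_mulVec, Matrix.one_mulVec]
    rw [quadForm, Matrix.sub_mulVec, hHv, h2, add_sub_cancel_right, hv, Complex.one_re]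
  rw [hone, one_pow, mul_one] at hmain
  refine hmain.trans (mul_le_mul_of_nonneg_left (pow_le_pow_left₀ ?_ ?_ k) (by positivity))
  · exact quadForm_nonneg (hK.hadamard (gram_posSemidef f)) v
  · exact quadForm_inv_hadamard_gram_le f hsub hadd hHf hv

/-- The constant `8` is `2 · 4`: the exponent `2T` contributes `2`, and `log (1 + 4 / d) ≤ 4 / d`
contributes `4`. -/
theorem le_numQueries {E G : Type*} [Fintype D] [DecidableEq E] [Fintype G] [DecidableEq G]
    [AddCommGroup G] (enc : D ↪ G) (f : 𝒟 → E) {Γ : Matrix 𝒟 𝒟 ℂ}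
    (hΓ : IsAdversaryMatrix 𝒟 Γ) {δ : ℝ} (hδ : 0 < δ) {k : ℕ}
    (A : Algorithm (Fin k × ι) G (Fin k → E))
    (hA : A.Computes enc (1 - δ ^ ((k : ℝ) / 2)) (funPow k f)) :
    k * Real.log (3 * δ / 2) / 8 * specNorm (Γ ⊙ (allOnes 𝒟 - gram f)) ≤ A.numQueries := by
  have hd0 : 0 ≤ specNorm (Γ ⊙ (allOnes 𝒟 - gram f)) := norm_nonneg _
  rcases hd0.eq_or_lt with h0 | hd
  · rw [← h0, mul_zero]
    positivity
  have h := pow_le_of_computes enc f hΓ hd (Real.rpow_nonneg hδ.le _) A hA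
  set d := specNorm (Γ ⊙ (allOnes 𝒟 - gram f))
  have hsq : (δ ^ ((k : ℝ) / 2)) ^ 2 = δ ^ k := by
    rw [← Real.rpow_natCast, ← Real.rpow_mul hδ.le, Nat.cast_ofNat,
      div_mul_cancel₀ _ two_ne_zero, Real.rpow_natCast]
  rw [hsq] at h
  have hle : (3 * δ / 2) ^ k ≤ (1 + 2 * (2 / d)) ^ (2 * A.numQueries) := by
    calc (3 * δ / 2) ^ k = δ ^ k * (3 / 2) ^ k := by rw [← mul_pow]; ring
      _ ≤ (1 + 2 * (2 / d)) ^ (2 * A.numQueries) * (2 / 3) ^ k * (3 / 2) ^ k := by gcongr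
      _ = _ := by rw [mul_assoc, ← mul_pow]; norm_num
  have hlog := Real.log_le_log (by positivity) hle
  rw [Real.log_pow, Real.log_pow] at hlog
  have hr : Real.log (1 + 2 * (2 / d)) ≤ 4 / d := by
    have := Real.log_le_sub_one_of_pos (x := 1 + 2 * (2 / d)) (by positivity)
    calc _ ≤ _ := this
      _ = 4 / d := by ring
  have hfin := hlog.trans (mul_le_mul_of_nonneg_left hr (Nat.cast_nonneg _))
  push_cast at hfin
  calc k * Real.log (3 * δ / 2) / 8 * d ≤ 2 * A.numQueries * (4 / d) / 8 * d := by gcongr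
    _ = A.numQueries := by field_simp; ring

end DirectProduct

end QuantumQuery

theorem mainTheorem5 {D E G : Type*} [Fintype D] [DecidableEq D] [DecidableEq E]
    [Fintype G] [DecidableEq G] [AddCommGroup G] (enc : D ↪ G)
    {n : ℕ} (𝒟 : Finset (Fin n → D)) (f : 𝒟 → E)
    (δ : ℝ) (hδ : 2 / 3 ≤ δ) (hδ1 : δ ≤ 1) (k : ℕ) (hk : 0 < k) :
    ENNReal.ofReal (k * Real.log (3 * δ / 2) / 8) *
        QuantumQuery.advBound (QuantumQuery.gram f) ≤
      ((QuantumQuery.queryComplexity enc (1 - δ ^ ((k : ℝ) / 2))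
        (QuantumQuery.funPow k f) : ℕ∞) : ℝ≥0∞) := by
  have hlog : 0 ≤ k * Real.log (3 * δ / 2) / 8 := by
    have := Real.log_nonneg (x := 3 * δ / 2) (by linarith)
    positivity
  simp only [QuantumQuery.advBound, QuantumQuery.queryComplexity, ENat.toENNReal_iInf,
    ENNReal.mul_iSup]
  refine iSup₂_le fun Γ hΓ => le_iInf₂ fun A hA => ?_
  rw [← ENNReal.ofReal_mul hlog, ENat.toENNReal_coe, ← ENNReal.ofReal_natCast]
  exact ENNReal.ofReal_le_ofReal
    (QuantumQuery.le_numQueries enc f hΓ (by linarith) A hA)
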